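/- Let $\mathbb U=\{z\in\mathbb C:|z|<1\}$ and let $\mathcal H[1,1]$ be the class of holomorphic functions $P$ on $\mathbb U$ with $P(0)=1$. For functions $g,h$ on $\mathbb U$ write $g\prec h$ if $g=h\circ\omega$ for some holomorphic $\omega:\mathbb U\to\mathbb U$ with $\omega(0)=0$. Let $p\ge 1$ be an integer, let $\eta,\mu,\sigma,\gamma\in\mathbb C$ with $(\eta,\mu)\ne(0,0)$ and $\gamma\neq0$, and let $f(z)=z^p+\sum_{k\ge p+1}a_kz^k$ be holomorphic in $\mathbb U$. Assume that $$\mathscr F_p^{\eta,\mu}[f](z)=\Big[\frac{f'(z)}{pz^{p-1}}\Big]^{\eta}\Big[\frac{z^p}{f(z)}\Big]^{\mu},\qquad \mathscr F_p^{\eta,\mu}[f](0)=1,$$ defines a function in $\mathcal H[1,1]$; here the powers are principal near the origin (where both bases are close to $1$), and $\mathscr F_p^{\eta,\mu}[f]$ denotes the holomorphic function on $\mathbb U$ that they determine. Let $$\Psi(z)=\mathscr F_p^{\eta,\mu}[f](z)\left\{\sigma+\gamma\left[\eta\Big(1-p+\frac{zf''(z)}{f'(z)}\Big)+\mu\Big(p-\frac{zf'(z)}{f(z)}\Big)\right]\right\},$$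 with removable singularities removed. Let $q$ be univalent (holomorphic and injective) in $\mathbb U$ with $q(0)=1$ and $$\operatorname{Re}\Big(1+\frac{zq''(z)}{q'(z)}\Big)>\max\Big\{0,-\operatorname{Re}\frac{\sigma}{\gamma}\Big\}\qquad(z\in\mathbb U).$$ If $\Psi(z)\prec\sigma q(z)+\gamma zq'(z)$, then $\mathscr F_p^{\eta,\mu}[f]\prec q$. Moreover, $q$ is the best dominant of the differential subordination $$\sigma P(z)+\gamma zP'(z)\prec\sigma q(z)+\gamma zq'(z),\qquad P\in\mathcal H[1,1];$$ that is, every solution $P\in\mathcal H[1,1]$ of it satisfies $P\prec q$, and $q\prec r$ for every holomorphic $r$ on $\mathbb U$ such that $P\prec r$ for all these solutions $P$. -/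

import Mathlib

open Filter Topology

noncomputable section

namespace DiffSub

/-- The open unit disc `𝕌`. -/
def disc : Set ℂ := Metric.ball (0 : ℂ) 1

/-- Holomorphic on the unit disc: the class `ℋ(𝕌)`. Values outside `𝕌` are irrelevant throughout. -/
def Holo (g : ℂ → ℂ) : Prop := DifferentiableOn ℂ g disc

/-- The class `ℋ[a,1]`: holomorphic on `𝕌` of the form `a + a₁ z + ⋯`. -/
def HoloClass (a : ℂ) : Set (ℂ → ℂ) := {g | Holo g ∧ g 0 = a}

/-- Univalent on the unit disc: holomorphic and injective. -/
def Univalent (g : ℂ → ℂ) : Prop := Holo g ∧ Set.InjOn g disc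

/-- Subordination `g ≺ h`: `g = h ∘ ω` on `𝕌` for some analytic `ω : 𝕌 → 𝕌` with `ω 0 = 0`. -/
def Subordinate (g h : ℂ → ℂ) : Prop :=
  ∃ ω : ℂ → ℂ, Holo ω ∧ Set.MapsTo ω disc disc ∧ ω 0 = 0 ∧ ∀ z ∈ disc, g z = h (ω z)

/-- `P ∈ ℋ[a,1]` solves the first-order differential subordination
`ψ(P(z), z P'(z); z) ≺ h(z)`. -/
def IsSolution (ψ : ℂ → ℂ → ℂ → ℂ) (h : ℂ → ℂ) (a : ℂ) (P : ℂ → ℂ) : Prop :=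
  P ∈ HoloClass a ∧ Subordinate (fun z => ψ (P z) (z * deriv P z) z) h

/-- `q` is a dominant of `ψ(P(z), z P'(z); z) ≺ h(z)`: every solution `P ∈ ℋ[a,1]` satisfies
`P ≺ q`. -/
def IsDominant (ψ : ℂ → ℂ → ℂ → ℂ) (h : ℂ → ℂ) (a : ℂ) (q : ℂ → ℂ) : Prop :=
  Holo q ∧ ∀ P : ℂ → ℂ, IsSolution ψ h a P → Subordinate P q

/-- `q` is the best dominant: a univalent dominant subordinate to every dominant. -/
def IsBestDominant (ψ : ℂ → ℂ → ℂ → ℂ) (h : ℂ → ℂ) (a : ℂ) (q : ℂ → ℂ) : Prop :=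
  Univalent q ∧ IsDominant ψ h a q ∧
    ∀ r : ℂ → ℂ, IsDominant ψ h a r → Subordinate q r

/-- The class `𝒜_p`: functions holomorphic on `𝕌` of the form `z^p + ∑_{k ≥ p+1} a_k z^k`. -/
def ClassA (p : ℕ) : Set (ℂ → ℂ) :=
  {f | Holo f ∧ ∃ a : ℕ → ℂ, ∀ z ∈ disc,
    HasSum (fun k : ℕ => a (p + 1 + k) * z ^ (p + 1 + k)) (f z - z ^ p)}

/-- The expression `[f'(z) / (p z^(p-1))]^η [z^p / f(z)]^μ` with principal powers. -/
def principalProduct (p : ℕ) (η μ : ℂ) (f : ℂ → ℂ) (z : ℂ) : ℂ :=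
  (deriv f z / ((p : ℂ) * z ^ (p - 1))) ^ η * (z ^ p / f z) ^ μ

/-- `F` is the member of `ℋ[1,1]` given by the principal-power expression.
Both bases tend to `1` at the origin, so the principal powers determine an analytic germ there with
value `1`, and hence at most one such `F` on `𝕌`. If the principal expression, with value `1` at the
origin, is itself holomorphic on all of `𝕌`, it is this `F`; if both bases are zero-free on `𝕌`,
then `F` is the product of the holomorphic branches of the two powers with value `1` at `0`. -/
def IsOperatorValue (p : ℕ) (η μ : ℂ) (f F : ℂ → ℂ) : Prop :=
  F ∈ HoloClass 1 ∧ ∀ᶠ z in 𝓝[≠] (0 : ℂ), F z = principalProduct p η μ f z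

/-- The class `𝒜₀`: those `f ∈ 𝒜_p` for which the operator is defined, that is, gives a member
of `ℋ[1,1]`. -/
def ClassA0 (p : ℕ) (η μ : ℂ) : Set (ℂ → ℂ) :=
  {f | f ∈ ClassA p ∧ ∃ F : ℂ → ℂ, IsOperatorValue p η μ f F}

open scoped Classical in
/-- The operator `f ↦ ℱ_p^{η,μ}[f]`; used only on `𝒜₀`. -/
def operatorF (p : ℕ) (η μ : ℂ) (f : ℂ → ℂ) : ℂ → ℂ :=
  if h : ∃ F : ℂ → ℂ, IsOperatorValue p η μ f F then h.choose else principalProduct p η μ f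

/-- The formula
`ℱ[f](z) {σ + γ [η (1 - p + z f''(z)/f'(z)) + μ (p - z f'(z)/f(z))]}`,
meaningful where `f(z) ≠ 0` and `f'(z) ≠ 0`. -/
def psiFormula (p : ℕ) (η μ σ γ : ℂ) (f : ℂ → ℂ) (z : ℂ) : ℂ :=
  operatorF p η μ f z *
    (σ + γ * (η * (1 - (p : ℂ) + z * deriv (deriv f) z / deriv f z)
      + μ * ((p : ℂ) - z * deriv f z / f z)))

/-- The function `Ψ`: the formula above with its removable singularities (at the origin and at
other zeros of `f` or `f'`) filled in by the limit. At the remaining points of `𝕌` the formula is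
continuous and the limit is its value. -/
def Psi (p : ℕ) (η μ σ γ : ℂ) (f : ℂ → ℂ) (z : ℂ) : ℂ :=
  limUnder (𝓝[≠] z) (psiFormula p η μ σ γ f)

end DiffSub

end

noncomputable section

namespace DiffSub

/-! Logarithmic differentiation turns `Ψ` into `σF + γzF'` for the operator value `F` (`Psi_eq`), so
everything reduces to the linear subordination `cP + zP' ≺ h`, with `c = σ/γ` and `h = cq + zq'`
(`subordinate_of_linear_subordinate`).

The hypothesis says that `q` is convex and that `h'/q' = c + 1 + zq''/q'` has positive real part, so
`h` is close-to-convex with respect to `q`. If `P` fails to map some disc `‖z‖ < ρ` into `q` of that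
disc, take a first exit point `z₀`, with `P z₀ = q ζ₀` and `‖ζ₀‖ = ρ`. Jack's lemma gives `z₀P'(z₀)
= mζ₀q'(ζ₀)` with `m ≥ 1`, so `cP + zP'` at `z₀` lies on the ray from `h ζ₀` in the direction
`ζ₀q'(ζ₀)`. By the Schwarz lemma this value is also `h (ω z₀)` with `‖ω z₀‖ < ρ`, which
`ne_add_mul_deriv` forbids. Working with `ρ < 1` avoids any boundary regularity of `q`.

Best dominance is immediate, since `q` itself solves the subordination. -/

/-! ### Boundary maxima and Jack's lemma. -/

/-- At a point where the real part of `F` is maximal over a closed disc centred at `0`, the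
logarithmic-type derivative `z F'(z)` is a nonnegative real number. -/
theorem exists_mul_deriv_eq_of_re_le {F : ℂ → ℂ} {z₀ : ℂ} (hF : DifferentiableAt ℂ F z₀)
    (hmax : ∀ z, ‖z‖ ≤ ‖z₀‖ → (F z).re ≤ (F z₀).re) :
    ∃ s : ℝ, 0 ≤ s ∧ z₀ * deriv F z₀ = s := by
  set w := z₀ * deriv F z₀ with hw
  -- First-order condition at the maximum along the segment from `z₀` to `z₀ * u`, which stays in
  -- the closed disc.
  have key : ∀ u : ℂ, ‖u‖ ≤ 1 → (w * u).re ≤ w.re := by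
    intro u hu
    have hmem : z₀ * u ∈ Metric.closedBall (0 : ℂ) ‖z₀‖ := by
      rw [mem_closedBall_zero_iff, norm_mul]
      exact mul_le_of_le_one_right (norm_nonneg _) hu
    have hmem0 : z₀ ∈ Metric.closedBall (0 : ℂ) ‖z₀‖ := by simp
    have hseg := (convex_closedBall (0 : ℂ) ‖z₀‖).segment_subset hmem0 hmem
    have hloc : IsLocalMaxOn (fun z => (F z).re) (Metric.closedBall (0 : ℂ) ‖z₀‖) z₀ := by
      refine eventually_nhdsWithin_of_forall fun z hz => hmax z ?_
      simpa using hz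
    have hd : HasFDerivAt (fun z => (F z).re)
        (Complex.reCLM.comp
          ((ContinuousLinearMap.toSpanSingleton ℂ (deriv F z₀)).restrictScalars ℝ)) z₀ :=
      Complex.reCLM.hasFDerivAt.comp z₀ (hF.hasDerivAt.hasFDerivAt.restrictScalars ℝ)
    have h := hloc.hasFDerivWithinAt_nonpos hd.hasFDerivWithinAt
      (sub_mem_posTangentConeAt_of_segment_subset hseg)
    have h2 : ((z₀ * u - z₀) * deriv F z₀).re ≤ 0 := by simpa using h
    have h3 : (z₀ * u - z₀) * deriv F z₀ = w * u - w := by rw [hw]; ring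
    rw [h3, Complex.sub_re] at h2
    linarith
  have hre : ‖w‖ ≤ w.re := by
    rcases eq_or_ne w 0 with h0 | h0
    · simp [h0]
    · have hn : ‖w‖ ≠ 0 := norm_ne_zero_iff.mpr h0
      -- This `u` rotates `w` onto `‖w‖`.
      have h := key ((starRingEnd ℂ) w / ‖w‖) (by simp [hn])
      have e : w * ((starRingEnd ℂ) w / ‖w‖) = (‖w‖ : ℂ) := by
        rw [← mul_div_assoc, Complex.mul_conj, Complex.normSq_eq_norm_sq]
        have : (‖w‖ : ℂ) ≠ 0 := by exact_mod_cast hn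
        push_cast
        field_simp
      rwa [e, Complex.ofReal_re] at h
  have heq : w.re = ‖w‖ := le_antisymm (Complex.re_le_norm w) hre
  have him : w.im = 0 := Complex.abs_re_eq_norm.mp
    (by rw [heq, abs_of_nonneg (norm_nonneg w)])
  exact ⟨w.re, heq ▸ norm_nonneg w, Complex.ext (by simp) (by simp [him])⟩

/-- The real part of a function holomorphic near a closed disc attains its maximum on the
bounding circle. -/
theorem exists_norm_eq_re_le {F : ℂ → ℂ} {r : ℝ} (hr : 0 < r)
    (hF : DifferentiableOn ℂ F (Metric.closedBall 0 r)) :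
    ∃ z₀ : ℂ, ‖z₀‖ = r ∧ ∀ z, ‖z‖ ≤ r → (F z).re ≤ (F z₀).re := by
  have hcl : closure (Metric.ball (0 : ℂ) r) = Metric.closedBall 0 r := closure_ball _ hr.ne'
  -- Since `‖exp F‖ = exp (Re F)`, the maximum modulus principle applies to the real part.
  have hd : DiffContOnCl ℂ (fun z => Complex.exp (F z)) (Metric.ball 0 r) := by
    apply DifferentiableOn.diffContOnCl
    rw [hcl]
    exact hF.cexp
  obtain ⟨z₀, hz₀, hmax⟩ := Complex.exists_mem_frontier_isMaxOn_norm Metric.isBounded_ball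
    ⟨0, Metric.mem_ball_self hr⟩ hd
  rw [frontier_ball _ hr.ne', mem_sphere_zero_iff_norm] at hz₀
  refine ⟨z₀, hz₀, fun z hz => ?_⟩
  have h := hmax (show z ∈ closure (Metric.ball (0 : ℂ) r) by rw [hcl]; simpa using hz)
  simpa [Complex.norm_exp] using h

/-- **Jack's lemma**. -/
theorem jack_lemma {W : ℂ → ℂ} {z₀ : ℂ} (hz₀ : z₀ ≠ 0) (hW0 : W 0 = 0)
    (hW : ∀ z, ‖z‖ ≤ ‖z₀‖ → DifferentiableAt ℂ W z)
    (hmax : ∀ z, ‖z‖ ≤ ‖z₀‖ → ‖W z‖ ≤ ‖W z₀‖) :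
    ∃ m : ℝ, 1 ≤ m ∧ z₀ * deriv W z₀ = m * W z₀ := by
  rcases eq_or_ne (W z₀) 0 with hw | hw
  · have hzero : ∀ z, ‖z‖ ≤ ‖z₀‖ → W z = 0 := fun z hz => by
      simpa [hw] using hmax z hz
    -- Here `W` vanishes on the closed disc; `c = 1` and `c = -1` make both `z₀W'(z₀)` and its
    -- negative nonnegative, hence zero.
    have hre : ∀ c : ℂ, ∃ s : ℝ, 0 ≤ s ∧ z₀ * (c * deriv W z₀) = s := fun c => by
      obtain ⟨s, hs, h⟩ := exists_mul_deriv_eq_of_re_le (F := fun z => c * W z) (z₀ := z₀)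
        ((hW z₀ le_rfl).const_mul c) (fun z hz => by simp [hzero z hz, hw])
      exact ⟨s, hs, by rw [← h, deriv_const_mul _ (hW z₀ le_rfl)]⟩
    obtain ⟨s, hs, h1⟩ := hre 1
    obtain ⟨t, ht, h2⟩ := hre (-1)
    have h3 : ((s + t : ℝ) : ℂ) = 0 := by push_cast; rw [← h1, ← h2]; ring
    have h4 : s + t = 0 := by exact_mod_cast h3
    have h5 : s = 0 := by linarith
    refine ⟨1, le_rfl, ?_⟩
    rw [hw, mul_zero]
    simpa [h5] using h1
  set φ := dslope W 0 with hφ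
  have hφz : ∀ z, z ≠ 0 → W z = z * φ z := fun z hz => by
    rw [hφ, dslope_of_ne _ hz, slope_def_field, hW0]
    field_simp
    ring
  have hr : 0 < ‖z₀‖ := norm_pos_iff.mpr hz₀
  have hφd : DifferentiableOn ℂ φ (Metric.closedBall 0 ‖z₀‖) :=
    (Complex.differentiableOn_dslope (Metric.closedBall_mem_nhds 0 hr)).mpr
      fun z hz => (hW z (by simpa using hz)).differentiableWithinAt
  have hev : φ =ᶠ[𝓝 z₀] fun z => W z / z := by
    filter_upwards [isOpen_ne.mem_nhds hz₀] with z hz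
    rw [hφz z hz, mul_div_cancel_left₀ _ hz]
  have hφd0 : DifferentiableAt ℂ φ z₀ :=
    ((hW z₀ le_rfl).div differentiableAt_id hz₀).congr_of_eventuallyEq hev
  have hbd : ∀ z, ‖z‖ = ‖z₀‖ → ‖φ z‖ ≤ ‖φ z₀‖ := fun z hz => by
    have hz0 : z ≠ 0 := norm_pos_iff.mp (hz ▸ hr)
    have h := hmax z hz.le
    rw [hφz z hz0, hφz z₀ hz₀, norm_mul, norm_mul, hz] at h
    exact le_of_mul_le_mul_left h hr
  have hall : ∀ z, ‖z‖ ≤ ‖z₀‖ → ‖φ z‖ ≤ ‖φ z₀‖ := fun z hz => by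
    refine Complex.norm_le_of_forall_mem_frontier_norm_le (U := Metric.ball (0 : ℂ) ‖z₀‖)
      Metric.isBounded_ball ?_ ?_ ?_
    · apply DifferentiableOn.diffContOnCl
      rwa [closure_ball _ hr.ne']
    · intro y hy
      rw [frontier_ball _ hr.ne', mem_sphere_zero_iff_norm] at hy
      exact hbd y hy
    · rw [closure_ball _ hr.ne']; simpa using hz
  have hφ0 : φ z₀ ≠ 0 := fun h => hw (by rw [hφz z₀ hz₀, h, mul_zero])
  -- With `W = zφ`, the conjugate factor makes `z₀` a maximum of a real part, so `z₀φ'/φ ≥ 0` there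
  -- and `z₀W'/W = 1 + z₀φ'/φ ≥ 1`.
  obtain ⟨s, hs, h⟩ := exists_mul_deriv_eq_of_re_le
    (F := fun z => (starRingEnd ℂ) (φ z₀) * φ z) (z₀ := z₀) (hφd0.const_mul _) (fun z hz => by
      have h1 : ((starRingEnd ℂ) (φ z₀) * φ z₀).re = ‖φ z₀‖ * ‖φ z₀‖ := by
        rw [mul_comm, Complex.mul_conj, Complex.ofReal_re, Complex.normSq_eq_norm_sq, sq]
      calc ((starRingEnd ℂ) (φ z₀) * φ z).re ≤ ‖(starRingEnd ℂ) (φ z₀) * φ z‖ :=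
            Complex.re_le_norm _
        _ = ‖φ z₀‖ * ‖φ z‖ := by rw [norm_mul, Complex.norm_conj]
        _ ≤ ‖φ z₀‖ * ‖φ z₀‖ := by gcongr; exact hall z hz
        _ = _ := h1.symm)
  rw [deriv_const_mul _ hφd0] at h
  have hn : 0 < ‖φ z₀‖ ^ 2 := by positivity
  have hd : deriv W z₀ = φ z₀ + z₀ * deriv φ z₀ := by
    have hWe : W =ᶠ[𝓝 z₀] fun z => z * φ z := by
      filter_upwards [isOpen_ne.mem_nhds hz₀] with z hz using hφz z hz
    rw [hWe.deriv_eq, ((hasDerivAt_id' z₀).fun_mul hφd0.hasDerivAt).deriv]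
    simp
  refine ⟨1 + s / ‖φ z₀‖ ^ 2, by have := div_nonneg hs hn.le; linarith, ?_⟩
  have hc : (φ z₀) * (starRingEnd ℂ) (φ z₀) = (‖φ z₀‖ ^ 2 : ℝ) := by
    rw [Complex.mul_conj, Complex.normSq_eq_norm_sq]
  have hnc : ((‖φ z₀‖ ^ 2 : ℝ) : ℂ) ≠ 0 := by exact_mod_cast hn.ne'
  rw [hd, hφz z₀ hz₀]
  push_cast [-Complex.ofReal_pow]
  field_simp
  rw [← h, ← hc]
  ring

/-! ### Univalence and nonvanishing derivative. -/

/-- An injective holomorphic function has nonvanishing derivative. -/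
theorem deriv_ne_zero_of_injOn {f : ℂ → ℂ} {s : Set ℂ} {z₀ : ℂ} (hs : s ∈ 𝓝 z₀)
    (hf : AnalyticAt ℂ f z₀) (hinj : Set.InjOn f s) : deriv f z₀ ≠ 0 := by
  intro hd
  have hF : AnalyticAt ℂ (fun z => f z - f z₀) z₀ := hf.sub analyticAt_const
  have hne : analyticOrderAt (fun z => f z - f z₀) z₀ ≠ ⊤ := by
    intro htop
    rw [analyticOrderAt_eq_top] at htop
    have h1 : ∀ᶠ z in 𝓝[≠] z₀, f z - f z₀ = 0 ∧ z ∈ s ∧ z ≠ z₀ :=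
      (htop.filter_mono nhdsWithin_le_nhds).and
        ((Filter.Eventually.filter_mono nhdsWithin_le_nhds hs).and self_mem_nhdsWithin)
    obtain ⟨z, h1, h2, h3⟩ := h1.exists
    exact h3 (hinj h2 (mem_of_mem_nhds hs) (sub_eq_zero.mp h1))
  obtain ⟨n, hn⟩ := ENat.ne_top_iff_exists.mp hne
  obtain ⟨g, hg, hg0, hfg⟩ := (hF.analyticOrderAt_eq_natCast).mp hn.symm
  have hn2 : 2 ≤ n := by
    rcases n with _ | _ | n
    · exfalso
      have := hfg.self_of_nhds
      simp at this
      exact hg0 this.symm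
    · exfalso
      have h1 : deriv (fun z => f z - f z₀) z₀ = g z₀ := by
        rw [EventuallyEq.deriv_eq hfg]
        simp only [zero_add, pow_one, smul_eq_mul]
        rw [(((hasDerivAt_id' z₀).sub_const z₀).fun_mul hg.differentiableAt.hasDerivAt).deriv]
        simp
      rw [deriv_sub_const, hd] at h1
      exact hg0 h1.symm
    · omega
  have hn0 : (n : ℂ) ≠ 0 := by
    have : n ≠ 0 := by omega
    exact_mod_cast this
  -- A local coordinate in which `f - f z₀` is a constant times `u ^ n`; the principal logarithm is
  -- safe because `g z / g z₀` is near `1`.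
  set u : ℂ → ℂ := fun z => (z - z₀) * Complex.exp (Complex.log (g z / g z₀) / n) with hu
  have hgd : AnalyticAt ℂ (fun z => g z / g z₀) z₀ := hg.div analyticAt_const hg0
  have hg1 : g z₀ / g z₀ = 1 := div_self hg0
  have hka : AnalyticAt ℂ (fun z => Complex.exp (Complex.log (g z / g z₀) / n)) z₀ :=
    ((hgd.clog (by simp [hg1])).div analyticAt_const hn0).cexp
  have hua : AnalyticAt ℂ u z₀ := (analyticAt_id.sub analyticAt_const).mul hka
  have hud : HasStrictDerivAt u 1 z₀ := by
    have h := hua.hasStrictDerivAt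
    have e : deriv u z₀ = 1 := by
      rw [hu, (((hasDerivAt_id' z₀).sub_const z₀).fun_mul hka.differentiableAt.hasDerivAt).deriv]
      simp [hg1]
    rwa [e] at h
  have hmap := hud.map_nhds_eq one_ne_zero
  have hu0 : u z₀ = 0 := by simp [hu]
  rw [hu0] at hmap
  have hT : ∀ᶠ z in 𝓝 z₀, z ∈ s ∧ f z - f z₀ = u z ^ n * g z₀ := by
    have hgne : ∀ᶠ z in 𝓝 z₀, g z ≠ 0 := hg.continuousAt.eventually_ne hg0
    filter_upwards [hs, hfg, hgne] with z h1 h2 h3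
    refine ⟨h1, ?_⟩
    have h4 : g z / g z₀ ≠ 0 := div_ne_zero h3 hg0
    rw [h2, hu]
    simp only [mul_pow, smul_eq_mul]
    rw [← Complex.exp_nat_mul, mul_div_cancel₀ _ hn0, Complex.exp_log h4]
    field_simp
  have him : u '' {z | z ∈ s ∧ f z - f z₀ = u z ^ n * g z₀} ∈ 𝓝 (0 : ℂ) := by
    rw [← hmap]; exact image_mem_map hT
  set ζ := Complex.exp (2 * Real.pi * Complex.I / n) with hζ
  have hprim : IsPrimitiveRoot ζ n := Complex.isPrimitiveRoot_exp n (by omega)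
  -- The points with coordinates `ε` and `ζ * ε` have the same `f`-value, contradicting injectivity
  -- when `n ≥ 2`.
  have hrot : ∀ᶠ ε in 𝓝 (0 : ℂ), ζ * ε ∈ u '' {z | z ∈ s ∧ f z - f z₀ = u z ^ n * g z₀} := by
    have hc : Tendsto (fun ε : ℂ => ζ * ε) (𝓝 0) (𝓝 0) := by
      have : Continuous fun ε : ℂ => ζ * ε := by fun_prop
      simpa using this.tendsto 0
    exact hc.eventually him
  have hex : ∀ᶠ ε in 𝓝[≠] (0 : ℂ), ε ∈ u '' {z | z ∈ s ∧ f z - f z₀ = u z ^ n * g z₀} ∧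
      ζ * ε ∈ u '' {z | z ∈ s ∧ f z - f z₀ = u z ^ n * g z₀} ∧ ε ≠ 0 :=
    (Filter.Eventually.filter_mono nhdsWithin_le_nhds him).and
      ((hrot.filter_mono nhdsWithin_le_nhds).and self_mem_nhdsWithin)
  obtain ⟨ε, ⟨a, ⟨ha1, ha2⟩, ha3⟩, ⟨b, ⟨hb1, hb2⟩, hb3⟩, hε⟩ := hex.exists
  have hab : f a = f b := by
    have h1 : f b - f z₀ = f a - f z₀ := by
      rw [ha2, hb2, ha3, hb3, mul_pow, hprim.pow_eq_one, one_mul]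
    exact (sub_left_inj.mp h1).symm
  have h2 := hinj ha1 hb1 hab
  rw [← h2, ha3] at hb3
  have h3 : ζ = 1 := by
    have : (ζ - 1) * ε = 0 := by rw [sub_mul, ← hb3]; ring
    rcases mul_eq_zero.mp this with h | h
    · exact sub_eq_zero.mp h
    · exact absurd h hε
  exact hprim.ne_one (by omega) h3

theorem isOpen_disc : IsOpen disc := Metric.isOpen_ball

theorem mem_disc {z : ℂ} : z ∈ disc ↔ ‖z‖ < 1 := mem_ball_zero_iff

theorem zero_mem_disc : (0 : ℂ) ∈ disc := mem_disc.mpr (by simp)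

theorem isPreconnected_disc : IsPreconnected disc := (convex_ball (0 : ℂ) 1).isPreconnected

theorem Holo.differentiableAt {g : ℂ → ℂ} (hg : Holo g) {z : ℂ} (hz : z ∈ disc) :
    DifferentiableAt ℂ g z :=
  DifferentiableOn.differentiableAt hg (isOpen_disc.mem_nhds hz)

theorem Holo.analyticAt {g : ℂ → ℂ} (hg : Holo g) {z : ℂ} (hz : z ∈ disc) : AnalyticAt ℂ g z :=
  DifferentiableOn.analyticAt hg (isOpen_disc.mem_nhds hz)

theorem Holo.deriv {g : ℂ → ℂ} (hg : Holo g) : Holo (deriv g) :=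
  DifferentiableOn.deriv hg isOpen_disc

theorem Univalent.deriv_ne_zero {q : ℂ → ℂ} (hq : Univalent q) {z : ℂ} (hz : z ∈ disc) :
    deriv q z ≠ 0 :=
  deriv_ne_zero_of_injOn (isOpen_disc.mem_nhds hz) (hq.1.analyticAt hz) hq.2

/-! ### Convex and close-to-convex geometry. -/

/-- If `1 + z q''(z) / q'(z)` has positive real part, then `ζ ↦ arg (ζ q'(ζ))` is injective on
circles centred at the origin. -/
theorem eq_of_mul_deriv_eq {q : ℂ → ℂ} (hq : Holo q) (hq' : ∀ z ∈ disc, deriv q z ≠ 0)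
    (hconv : ∀ z ∈ disc, 0 < (1 + z * deriv (deriv q) z / deriv q z).re)
    {ζ₁ ζ₂ : ℂ} (h₁ : ζ₁ ∈ disc) (h₁₂ : ‖ζ₁‖ = ‖ζ₂‖) {t : ℝ} (ht : 0 < t)
    (h : ζ₁ * deriv q ζ₁ = t * (ζ₂ * deriv q ζ₂)) : ζ₁ = ζ₂ := by
  rcases eq_or_ne ζ₁ 0 with h0 | h0
  · rw [h0, norm_zero] at h₁₂
    rw [h0, norm_eq_zero.mp h₁₂.symm]
  set r := ‖ζ₁‖ with hr
  have hrpos : 0 < r := norm_pos_iff.mpr h0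
  have hr0 : (r : ℂ) ≠ 0 := by exact_mod_cast hrpos.ne'
  have hdd : DifferentiableOn ℂ (fun z => deriv (deriv q) z / deriv q z) disc :=
    DifferentiableOn.div hq.deriv.deriv hq.deriv hq'
  obtain ⟨G, hG⟩ := DifferentiableOn.isExactOn_ball hdd
  have hconst : ∀ z ∈ disc, deriv q z = deriv q 0 * Complex.exp (G z - G 0) := by
    have hd : ∀ z ∈ disc, HasDerivAt (fun z => deriv q z * Complex.exp (-G z)) 0 z := by
      intro z hz
      have h1 := (hq.deriv.differentiableAt hz).hasDerivAt.fun_mul (hG z hz).fun_neg.cexp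
      refine h1.congr_deriv ?_
      have := hq' z hz
      field_simp
      simp
    intro z hz
    have := isOpen_disc.is_const_of_deriv_eq_zero isPreconnected_disc
      (fun z hz => (hd z hz).differentiableAt.differentiableWithinAt)
      (fun z hz => (hd z hz).deriv) hz zero_mem_disc
    rw [Complex.exp_neg, Complex.exp_neg, ← div_eq_mul_inv, ← div_eq_mul_inv,
      div_eq_div_iff (Complex.exp_ne_zero _) (Complex.exp_ne_zero _)] at this
    rw [Complex.exp_sub, mul_div_assoc', eq_div_iff (Complex.exp_ne_zero _), this]
  let c : ℝ → ℂ := fun φ => r * Complex.exp (φ * Complex.I)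
  have hcd : ∀ φ, c φ ∈ disc := fun φ => by
    rw [mem_disc, norm_mul, Complex.norm_exp_ofReal_mul_I, mul_one, Complex.norm_real,
      Real.norm_of_nonneg hrpos.le]
    exact mem_disc.mp h₁
  have hcderiv : ∀ φ, HasDerivAt c (c φ * Complex.I) φ := fun φ => by
    have h1 : HasDerivAt (fun x : ℝ => (x : ℂ) * Complex.I) Complex.I φ := by
      simpa using (Complex.ofRealCLM.hasDerivAt (x := φ)).mul_const Complex.I
    simpa [c, mul_assoc] using h1.cexp.const_mul (r : ℂ)
  -- Up to a constant, a continuous argument of `ζq'(ζ)` along the circle.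
  let Φ : ℝ → ℝ := fun φ => φ + (G (c φ)).im
  have hΦd : ∀ φ, HasDerivAt Φ (1 + c φ * deriv (deriv q) (c φ) / deriv q (c φ)).re φ := by
    intro φ
    have h1 := (hG (c φ) (hcd φ)).comp φ (hcderiv φ)
    have h2 := Complex.imCLM.hasFDerivAt.comp_hasDerivAt φ h1
    have h3 := (hasDerivAt_id' φ).fun_add h2
    refine h3.congr_deriv ?_
    have e : deriv (deriv q) (c φ) / deriv q (c φ) * (c φ * Complex.I)
      = (c φ * deriv (deriv q) (c φ) / deriv q (c φ)) * Complex.I := by ring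
    simp only [Complex.imCLM_apply]
    rw [e, Complex.mul_I_im, Complex.add_re, Complex.one_re]
  have hmono : StrictMono Φ := strictMono_of_deriv_pos fun φ => by
    rw [(hΦd φ).deriv]
    exact hconv _ (hcd φ)
  have hcper : ∀ (φ : ℝ) (k : ℤ), c (φ + k * (2 * Real.pi)) = c φ := fun φ k => by
    simp only [c]
    congr 1
    rw [Complex.exp_eq_exp_iff_exists_int]
    exact ⟨k, by push_cast; ring⟩
  have hζ₁ : ζ₁ = c ζ₁.arg := (Complex.norm_mul_exp_arg_mul_I ζ₁).symm
  have hζ₂ : ζ₂ = c ζ₂.arg := by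
    simp only [c]
    rw [h₁₂, Complex.norm_mul_exp_arg_mul_I]
  have hd0 := hq' 0 zero_mem_disc
  have hlog : ∀ φ : ℝ, c φ * deriv q (c φ)
      = r * deriv q 0 * Complex.exp (φ * Complex.I + (G (c φ) - G 0)) := fun φ => by
    rw [hconst _ (hcd φ), Complex.exp_add]
    simp only [c]
    ring
  rw [hζ₁, hζ₂, hlog, hlog, mul_left_comm] at h
  have h' := mul_left_cancel₀ (mul_ne_zero hr0 hd0) h
  have htexp : (t : ℂ) = Complex.exp (Real.log t : ℝ) := by
    rw [← Complex.ofReal_exp, Real.exp_log ht]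
  rw [htexp, ← Complex.exp_add, Complex.exp_eq_exp_iff_exists_int] at h'
  obtain ⟨k, hk⟩ := h'
  have him := congrArg Complex.im hk
  -- The factor `t` only affects real parts of logarithms, and `Φ` gains exactly `2πk` over `k`
  -- turns.
  have heq : Φ ζ₁.arg = Φ (ζ₂.arg + k * (2 * Real.pi)) := by
    simp only [Φ, hcper]
    simp at him
    linarith
  rw [hζ₁, hmono.injective heq, hcper, ← hζ₂]

/-- Images of discs under a convex function lie on one side of their tangent lines. -/
theorem re_sub_mul_conj_nonneg {q : ℂ → ℂ} (hq : Holo q) (hq' : ∀ z ∈ disc, deriv q z ≠ 0)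
    (hconv : ∀ z ∈ disc, 0 < (1 + z * deriv (deriv q) z / deriv q z).re)
    {z ζ : ℂ} (hζ : ζ ∈ disc) (hz : ‖z‖ ≤ ‖ζ‖) :
    0 ≤ ((q ζ - q z) * (starRingEnd ℂ) (ζ * deriv q ζ)).re := by
  rcases eq_or_ne ζ 0 with h0 | h0
  · simp [h0]
  have hr : 0 < ‖ζ‖ := norm_pos_iff.mpr h0
  have hmem : ∀ w : ℂ, ‖w‖ ≤ ‖ζ‖ → w ∈ disc := fun w hw =>
    mem_disc.mpr (hw.trans_lt (mem_disc.mp hζ))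
  set e := (starRingEnd ℂ) (ζ * deriv q ζ) with he
  have hne : ζ * deriv q ζ ≠ 0 := mul_ne_zero h0 (hq' ζ hζ)
  have he0 : e ≠ 0 := (map_ne_zero _).mpr hne
  obtain ⟨z₀, hz₀, hmax⟩ := exists_norm_eq_re_le (F := fun w => e * q w) hr fun w hw =>
    ((hq.differentiableAt (hmem w (by simpa using hw))).const_mul e).differentiableWithinAt
  have hz₀d := hmem z₀ hz₀.le
  obtain ⟨s, hs, hse⟩ := exists_mul_deriv_eq_of_re_le (F := fun w => e * q w) (z₀ := z₀)
    ((hq.differentiableAt hz₀d).const_mul e) (by rwa [hz₀])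
  rw [deriv_const_mul _ (hq.differentiableAt hz₀d)] at hse
  have hz₀0 : z₀ ≠ 0 := norm_pos_iff.mp (hz₀ ▸ hr)
  have hs0 : s ≠ 0 := by
    rintro rfl
    exact mul_ne_zero hz₀0 (mul_ne_zero he0 (hq' z₀ hz₀d)) (by simpa using hse)
  have hspos : 0 < s := lt_of_le_of_ne hs hs0.symm
  have hnpos : 0 < Complex.normSq (ζ * deriv q ζ) := Complex.normSq_pos.mpr hne
  -- The maximizer of `Re (e * q)` has its normal `z₀q'(z₀)` in the direction of `ζq'(ζ)`; only one
  -- point of the circle does.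
  have heqz : z₀ = ζ := by
    refine eq_of_mul_deriv_eq hq hq' hconv hz₀d hz₀ (div_pos hspos hnpos) ?_
    have hmc := Complex.mul_conj (ζ * deriv q ζ)
    rw [← he] at hmc
    have hn0 : (Complex.normSq (ζ * deriv q ζ) : ℂ) ≠ 0 := by exact_mod_cast hnpos.ne'
    push_cast
    rw [div_mul_eq_mul_div, eq_div_iff hn0, ← hmc, ← hse]
    ring
  have := hmax z hz
  rw [heqz] at this
  rw [sub_mul, Complex.sub_re, mul_comm (q ζ), mul_comm (q z)]
  linarith

/-- If `q` is convex and `Re (h' / q') > 0`, the difference quotients of `h` with respect to `q`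
have positive real part. -/
theorem re_dslope_div_dslope_pos {q h : ℂ → ℂ} (hq : Univalent q)
    (hconv : ∀ z ∈ disc, 0 < (1 + z * deriv (deriv q) z / deriv q z).re)
    (hh : Holo h) (hpos : ∀ z ∈ disc, 0 < (deriv h z / deriv q z).re)
    {z ζ : ℂ} (hζ : ζ ∈ disc) (hz : ‖z‖ ≤ ‖ζ‖) (hζ0 : ζ ≠ 0) :
    0 < (dslope h ζ z / dslope q ζ z).re := by
  have hr : 0 < ‖ζ‖ := norm_pos_iff.mpr hζ0
  have hmem : ∀ w : ℂ, ‖w‖ ≤ ‖ζ‖ → w ∈ disc := fun w hw =>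
    mem_disc.mpr (hw.trans_lt (mem_disc.mp hζ))
  have hq' : ∀ z ∈ disc, deriv q z ≠ 0 := fun z hz => hq.deriv_ne_zero hz
  set A : ℂ → ℂ := fun w => dslope h ζ w / dslope q ζ w with hA
  have hsub : ∀ w ∈ disc, w ≠ ζ → q w - q ζ ≠ 0 := fun w hw hne h =>
    hne (hq.2 hw hζ (sub_eq_zero.mp h))
  have hqne : ∀ w ∈ disc, dslope q ζ w ≠ 0 := fun w hw => by
    rcases eq_or_ne w ζ with rfl | hne
    · rw [dslope_same]; exact hq' w hw
    · rw [dslope_of_ne _ hne, slope_def_field]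
      exact div_ne_zero (hsub w hw hne) (sub_ne_zero.mpr hne)
  have hnhds := isOpen_disc.mem_nhds hζ
  have hAd : DifferentiableOn ℂ A disc :=
    ((Complex.differentiableOn_dslope hnhds).mpr hh).div
      ((Complex.differentiableOn_dslope hnhds).mpr hq.1) hqne
  have hAeq : ∀ w ∈ disc, h w - h ζ = A w * (q w - q ζ) := fun w hw => by
    rcases eq_or_ne w ζ with rfl | hne
    · simp
    · simp only [hA]
      rw [dslope_of_ne _ hne, dslope_of_ne _ hne, slope_def_field, slope_def_field,
        div_div_div_cancel_right₀ (sub_ne_zero.mpr hne), div_mul_cancel₀ _ (hsub w hw hne)]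
  -- It suffices to treat the minimum of `Re A`. Off `ζ`, differentiating `h - h ζ = A * (q - q ζ)`
  -- there and using convexity gives `Re A ≥ Re (h'/q')`.
  obtain ⟨z₁, hz₁, hmin⟩ := exists_norm_eq_re_le (F := fun w => -A w) hr fun w hw =>
    (hAd.differentiableAt (isOpen_disc.mem_nhds (hmem w (by simpa using hw)))).neg.differentiableWithinAt
  have hz₁d := hmem z₁ hz₁.le
  have hA1 : DifferentiableAt ℂ A z₁ := hAd.differentiableAt (isOpen_disc.mem_nhds hz₁d)
  suffices hA1pos : 0 < (A z₁).re by
    have := hmin z hz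
    simp only [Complex.neg_re] at this
    change 0 < (A z).re
    linarith
  rcases eq_or_ne z₁ ζ with heq | hne
  · rw [heq]
    simp only [hA, dslope_same]
    exact hpos ζ hζ
  obtain ⟨s, hs, hse⟩ := exists_mul_deriv_eq_of_re_le (F := fun w => -A w) (z₀ := z₁)
    hA1.neg (by rwa [hz₁])
  rw [deriv.fun_neg] at hse
  have hder : deriv h z₁ = deriv A z₁ * (q z₁ - q ζ) + A z₁ * deriv q z₁ := by
    have h1 : (fun w => h w - h ζ) =ᶠ[𝓝 z₁] fun w => A w * (q w - q ζ) := by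
      filter_upwards [isOpen_disc.mem_nhds hz₁d] with w hw using hAeq w hw
    have h2 := h1.deriv_eq
    rwa [deriv_sub_const, (hA1.hasDerivAt.fun_mul
      ((hq.1.differentiableAt hz₁d).hasDerivAt.sub_const _)).deriv] at h2
  have hside := re_sub_mul_conj_nonneg hq.1 hq' hconv hz₁d (z := ζ) hz₁.ge
  have hz₁0 : z₁ ≠ 0 := norm_pos_iff.mp (hz₁ ▸ hr)
  set b := z₁ * deriv q z₁ with hb
  have hb0 : b ≠ 0 := mul_ne_zero hz₁0 (hq' z₁ hz₁d)
  have hkey : (deriv h z₁ / deriv q z₁ - A z₁) * b = -(s * (q z₁ - q ζ)) := by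
    have := hq' z₁ hz₁d
    rw [hder, hb, ← hse]
    field_simp
    ring
  have hn : 0 < Complex.normSq b := Complex.normSq_pos.mpr hb0
  have h3 : (deriv h z₁ / deriv q z₁ - A z₁) * (Complex.normSq b : ℂ)
      = -((s : ℂ) * ((q z₁ - q ζ) * (starRingEnd ℂ) b)) := by
    rw [← Complex.mul_conj, ← mul_assoc, hkey]
    ring
  have h4 := congrArg Complex.re h3
  rw [Complex.re_mul_ofReal, Complex.neg_re, Complex.re_ofReal_mul, Complex.sub_re] at h4
  have h5 := mul_nonneg hs hside
  have h6 := hpos z₁ hz₁d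
  nlinarith

/-- Points of the outward normal ray at `h ζ` are not values of `h` on the disc `‖z‖ < ‖ζ‖`. -/
theorem ne_add_mul_deriv {q h : ℂ → ℂ} (hq : Univalent q)
    (hconv : ∀ z ∈ disc, 0 < (1 + z * deriv (deriv q) z / deriv q z).re)
    (hh : Holo h) (hpos : ∀ z ∈ disc, 0 < (deriv h z / deriv q z).re)
    {z ζ : ℂ} (hζ : ζ ∈ disc) (hz : ‖z‖ < ‖ζ‖) {t : ℝ} (ht : 0 ≤ t) :
    h z ≠ h ζ + t * (ζ * deriv q ζ) := by
  intro heq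
  have hζ0 : ζ ≠ 0 := norm_pos_iff.mp ((norm_nonneg z).trans_lt hz)
  have hzd : z ∈ disc := mem_disc.mpr (hz.trans (mem_disc.mp hζ))
  have hzne : z ≠ ζ := by rintro rfl; exact lt_irrefl _ hz
  have hA := re_dslope_div_dslope_pos hq hconv hh hpos hζ hz.le hζ0
  have hside := re_sub_mul_conj_nonneg hq.1 (fun z hz => hq.deriv_ne_zero hz) hconv hζ hz.le
  have hN : q ζ - q z ≠ 0 := fun h => hzne (hq.2 hzd hζ (sub_eq_zero.mp h).symm)
  have hN' : q z - q ζ ≠ 0 := fun h => hzne (hq.2 hzd hζ (sub_eq_zero.mp h))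
  rw [dslope_of_ne _ hzne, dslope_of_ne _ hzne, slope_def_field, slope_def_field,
    div_div_div_cancel_right₀ (sub_ne_zero.mpr hzne)] at hA
  set A := (h z - h ζ) / (q z - q ζ) with hAdef
  have h1 : A * (q ζ - q z) = -(t * (ζ * deriv q ζ)) := by
    have : A * (q z - q ζ) = h z - h ζ := div_mul_cancel₀ _ hN'
    rw [heq] at this
    linear_combination -this
  have hn : 0 < Complex.normSq (q ζ - q z) := Complex.normSq_pos.mpr hN
  -- The left side has positive real part, the right side nonpositive by the tangent-line
  -- inequality.
  have h2 : (starRingEnd ℂ A) * (Complex.normSq (q ζ - q z) : ℂ)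
      = -((t : ℂ) * ((q ζ - q z) * (starRingEnd ℂ) (ζ * deriv q ζ))) := by
    have := congrArg (starRingEnd ℂ) h1
    rw [map_mul, map_neg, map_mul, Complex.conj_ofReal] at this
    rw [← Complex.mul_conj]
    linear_combination (q ζ - q z) * this
  have h3 := congrArg Complex.re h2
  rw [Complex.re_mul_ofReal, Complex.neg_re, Complex.re_ofReal_mul, Complex.conj_re] at h3
  have := mul_nonneg ht hside
  have := mul_pos hA hn
  linarith

/-! ### Inverses of univalent functions and the linear subordination. -/

/-- Univalent functions map open subsets of the disc to open sets. -/
theorem Univalent.isOpen_image {q : ℂ → ℂ} (hq : Univalent q) {s : Set ℂ} (hs : IsOpen s)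
    (hsd : s ⊆ disc) : IsOpen (q '' s) := by
  rw [isOpen_iff_mem_nhds]
  rintro _ ⟨z, hz, rfl⟩
  have h := (hq.1.analyticAt (hsd hz)).hasStrictDerivAt.map_nhds_eq (hq.deriv_ne_zero (hsd hz))
  rw [← h]
  exact image_mem_map (hs.mem_nhds hz)

/-- The inverse of a univalent function is holomorphic. -/
theorem Univalent.hasDerivAt_invFunOn {q : ℂ → ℂ} (hq : Univalent q) {ζ : ℂ} (hζ : ζ ∈ disc) :
    HasDerivAt (Function.invFunOn q disc) (deriv q ζ)⁻¹ (q ζ) := by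
  have hstrict := (hq.1.analyticAt hζ).hasStrictDerivAt
  have hleft : ∀ w ∈ disc, Function.invFunOn q disc (q w) = w := fun w hw =>
    hq.2.leftInvOn_invFunOn hw
  have hl : ∀ᶠ w in 𝓝 ζ, Function.invFunOn q disc (q w) = w := by
    filter_upwards [isOpen_disc.mem_nhds hζ] with w hw using hleft w hw
  exact (hstrict.to_local_left_inverse (hq.deriv_ne_zero hζ) hl).hasDerivAt

/-- If `q` is univalent, `P 0 = q 0` and `P` maps the disc into `q '' disc`, then `P ≺ q`. -/
theorem Univalent.subordinate_of_image_subset {q P : ℂ → ℂ} (hq : Univalent q) (hP : Holo P)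
    (h0 : P 0 = q 0) (himg : ∀ z ∈ disc, P z ∈ q '' disc) : Subordinate P q := by
  refine ⟨fun z => Function.invFunOn q disc (P z), ?_, ?_, ?_, ?_⟩
  · intro z hz
    obtain ⟨ζ, hζ, hPζ⟩ := himg z hz
    have h := hq.hasDerivAt_invFunOn hζ
    rw [hPζ] at h
    exact (h.differentiableAt.comp z (hP.differentiableAt hz)).differentiableWithinAt
  · exact fun z hz => Function.invFunOn_mem (himg z hz)
  · simp only [h0]
    exact hq.2.leftInvOn_invFunOn zero_mem_disc
  · exact fun z hz => (Function.invFunOn_eq (himg z hz)).symm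

/-- **Miller--Mocanu**: first-order linear differential subordination with convex dominant. -/
theorem subordinate_of_linear_subordinate {c : ℂ} {q P : ℂ → ℂ} (hq : Univalent q)
    (hconv : ∀ z ∈ disc, 0 < (1 + z * deriv (deriv q) z / deriv q z).re)
    (hc : ∀ z ∈ disc, 0 < (c + (1 + z * deriv (deriv q) z / deriv q z)).re)
    (hP : Holo P) (h0 : P 0 = q 0)
    (hsub : Subordinate (fun z => c * P z + z * deriv P z) (fun z => c * q z + z * deriv q z)) :
    Subordinate P q := by
  set h : ℂ → ℂ := fun z => c * q z + z * deriv q z with hh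
  have hhd : ∀ z ∈ disc, HasDerivAt h
      (c * deriv q z + (1 * deriv q z + z * deriv (deriv q) z)) z := fun z hz =>
    ((hq.1.differentiableAt hz).hasDerivAt.const_mul c).fun_add
      ((hasDerivAt_id' z).fun_mul (hq.1.deriv.differentiableAt hz).hasDerivAt)
  have hhH : Holo h := fun z hz => (hhd z hz).differentiableAt.differentiableWithinAt
  have hpos : ∀ z ∈ disc, 0 < (deriv h z / deriv q z).re := fun z hz => by
    have e : deriv h z / deriv q z = c + (1 + z * deriv (deriv q) z / deriv q z) := by
      have := hq.deriv_ne_zero hz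
      rw [(hhd z hz).deriv]
      field_simp
    rw [e]
    exact hc z hz
  obtain ⟨ω, hω, hωm, hω0, hωeq⟩ := hsub
  have hωle : ∀ z ∈ disc, ‖ω z‖ ≤ ‖z‖ := fun z hz =>
    Complex.norm_le_norm_of_mapsTo_ball hω
      (fun w hw => Metric.ball_subset_closedBall (hωm hw)) hω0 (mem_disc.mp hz)
  have hball : ∀ ρ : ℝ, ρ < 1 → ∀ z : ℂ, ‖z‖ < ρ → P z ∈ q '' Metric.ball 0 ρ := by
    intro ρ hρ z hz
    by_contra hcon
    have hρpos : 0 < ρ := (norm_nonneg z).trans_lt hz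
    have hcb : Metric.closedBall (0 : ℂ) ρ ⊆ disc := fun w hw =>
      mem_disc.mpr ((mem_closedBall_zero_iff.mp hw).trans_lt hρ)
    have hob : Metric.ball (0 : ℂ) ρ ⊆ disc := Metric.ball_subset_closedBall.trans hcb
    have hopen : IsOpen (q '' Metric.ball 0 ρ) := hq.isOpen_image Metric.isOpen_ball hob
    have hPc : ContinuousOn P (Metric.closedBall 0 ρ) :=
      (DifferentiableOn.continuousOn hP).mono hcb
    have hK : IsCompact (Metric.closedBall (0 : ℂ) ρ ∩ P ⁻¹' (q '' Metric.ball 0 ρ)ᶜ) :=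
      (isCompact_closedBall 0 ρ).of_isClosed_subset
        (hPc.preimage_isClosed_of_isClosed Metric.isClosed_closedBall hopen.isClosed_compl)
        Set.inter_subset_left
    -- A point of least modulus at which `P` leaves `q '' ball 0 ρ`.
    obtain ⟨z₀, ⟨hz₀b, hz₀P⟩, hz₀min⟩ := hK.exists_isMinOn
      ⟨z, mem_closedBall_zero_iff.mpr hz.le, hcon⟩ continuous_norm.continuousOn
    have hz₀lt : ‖z₀‖ < ρ :=
      (hz₀min ⟨mem_closedBall_zero_iff.mpr hz.le, hcon⟩ : ‖z₀‖ ≤ ‖z‖).trans_lt hz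
    have hz₀d : z₀ ∈ disc := hcb hz₀b
    have hin : ∀ w, ‖w‖ < ‖z₀‖ → P w ∈ q '' Metric.ball 0 ρ := fun w hw => by
      by_contra hw'
      exact absurd (hz₀min ⟨mem_closedBall_zero_iff.mpr (hw.trans hz₀lt).le, hw'⟩ :
        ‖z₀‖ ≤ ‖w‖) (not_le.mpr hw)
    have hz₀0 : z₀ ≠ 0 := by
      rintro rfl
      exact hz₀P ⟨0, Metric.mem_ball_self hρpos, h0.symm⟩
    have hr₀ : 0 < ‖z₀‖ := norm_pos_iff.mpr hz₀0
    have hqcl : IsClosed (q '' Metric.closedBall 0 ρ) :=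
      ((isCompact_closedBall (0 : ℂ) ρ).image_of_continuousOn
        ((DifferentiableOn.continuousOn hq.1).mono hcb)).isClosed
    have hincl : ∀ w, ‖w‖ ≤ ‖z₀‖ → P w ∈ q '' Metric.closedBall 0 ρ := fun w hw => by
      have hwcl : w ∈ closure (Metric.ball (0 : ℂ) ‖z₀‖) := by
        rw [closure_ball _ hr₀.ne']; simpa using hw
      have hPw : ContinuousAt P w :=
        (hP.differentiableAt (mem_disc.mpr (hw.trans_lt (hz₀lt.trans hρ)))).continuousAt
      have := hPw.continuousWithinAt.mem_closure_image hwcl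
      refine hqcl.closure_subset_iff.mpr ?_ this
      rintro _ ⟨v, hv, rfl⟩
      exact Set.image_mono Metric.ball_subset_closedBall (hin v (by simpa using hv))
    set Q := Function.invFunOn q disc with hQ
    have hQq : ∀ w ∈ disc, Q (q w) = w := fun w hw => hq.2.leftInvOn_invFunOn hw
    obtain ⟨ζ₀, hζ₀, hPζ₀⟩ := hincl z₀ le_rfl
    have hζ₀d := hcb hζ₀
    have hζ₀n : ‖ζ₀‖ = ρ := le_antisymm (mem_closedBall_zero_iff.mp hζ₀) <| by
      by_contra hlt
      exact hz₀P ⟨ζ₀, mem_ball_zero_iff.mpr (not_le.mp hlt), hPζ₀⟩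
    have hWz₀ : Q (P z₀) = ζ₀ := by rw [← hPζ₀, hQq _ hζ₀d]
    have hWd : ∀ w, ‖w‖ ≤ ‖z₀‖ → DifferentiableAt ℂ (fun w => Q (P w)) w := fun w hw => by
      obtain ⟨v, hv, hPv⟩ := hincl w hw
      have h1 := hq.hasDerivAt_invFunOn (hcb hv)
      rw [hPv] at h1
      exact h1.differentiableAt.comp w
        (hP.differentiableAt (mem_disc.mpr (hw.trans_lt (hz₀lt.trans hρ))))
    -- `q⁻¹ ∘ P` is bounded by `ρ` on `‖w‖ ≤ ‖z₀‖` and attains `ρ` at `z₀`.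
    obtain ⟨m, hm, hmeq⟩ := jack_lemma (W := fun w => Q (P w)) hz₀0
      (by simp only [h0]; exact hQq 0 zero_mem_disc) hWd (fun w hw => by
        obtain ⟨v, hv, hPv⟩ := hincl w hw
        simp only [hWz₀, hζ₀n]
        rw [← hPv, hQq v (hcb hv)]
        exact mem_closedBall_zero_iff.mp hv)
    have h1 := hq.hasDerivAt_invFunOn hζ₀d
    rw [hPζ₀] at h1
    have h2 := (h1.comp z₀ (hP.differentiableAt hz₀d).hasDerivAt).deriv
    change deriv (fun w => Q (P w)) z₀ = _ at h2
    simp only [h2, hWz₀] at hmeq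
    have hq0 := hq.deriv_ne_zero hζ₀d
    have hzP : z₀ * deriv P z₀ = m * (ζ₀ * deriv q ζ₀) := by
      field_simp at hmeq
      linear_combination hmeq
    refine ne_add_mul_deriv hq hconv hhH hpos hζ₀d (z := ω z₀) (t := m - 1)
      ((hωle z₀ hz₀d).trans_lt (hζ₀n ▸ hz₀lt)) (by linarith) ?_
    have h3 := hωeq z₀ hz₀d
    simp only at h3
    rw [← h3, hzP, ← hPζ₀]
    simp only [hh]
    push_cast
    ring
  refine hq.subordinate_of_image_subset hP h0 fun z hz => ?_
  obtain ⟨ρ, hzρ, hρ⟩ := exists_between (mem_disc.mp hz)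
  exact Set.image_mono (Metric.ball_subset_ball hρ.le) (hball ρ hρ z hzρ)

/-! ### The operator and `Ψ`. -/

theorem ClassA.exists_factorization {p : ℕ} {f : ℂ → ℂ} (hf : f ∈ ClassA p) :
    ∃ k : ℂ → ℂ, AnalyticAt ℂ k 0 ∧ k 0 = 1 ∧ f =ᶠ[𝓝 0] fun z => z ^ p * k z := by
  obtain ⟨-, a, ha⟩ := hf
  -- Convergence at `1/2` supplies the Weierstrass majorant on the disc of radius `1/2`.
  have hu : Summable fun k : ℕ => ‖a (p + 1 + k)‖ * (1 / 2 : ℝ) ^ k := by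
    have h := (ha (1 / 2) (mem_disc.mpr (by norm_num))).summable.norm.mul_left ((2 : ℝ) ^ (p + 1))
    refine h.congr fun k => ?_
    rw [norm_mul, norm_pow, pow_add _ (p + 1) k]
    have h2 : (2 : ℝ) ^ (p + 1) * (1 / 2) ^ (p + 1) = 1 := by rw [← mul_pow]; norm_num
    have h3 : ‖(1 / 2 : ℂ)‖ = 1 / 2 := by norm_num
    rw [h3]
    linear_combination ‖a (p + 1 + k)‖ * (1 / 2 : ℝ) ^ k * h2
  have hball : Metric.ball (0 : ℂ) (1 / 2) ∈ 𝓝 0 := Metric.ball_mem_nhds 0 (by norm_num)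
  set g : ℂ → ℂ := fun z => ∑' k : ℕ, a (p + 1 + k) * z ^ k with hg
  have hgd : DifferentiableOn ℂ g (Metric.ball 0 (1 / 2)) := by
    refine Complex.differentiableOn_tsum_of_summable_norm hu (fun k => by fun_prop)
      Metric.isOpen_ball fun k z hz => ?_
    rw [norm_mul, norm_pow]
    gcongr
    exact (mem_ball_zero_iff.mp hz).le
  have hga : AnalyticAt ℂ g 0 := hgd.analyticAt hball
  refine ⟨fun z => 1 + z * g z, analyticAt_const.add (analyticAt_id.mul hga), by simp, ?_⟩
  filter_upwards [isOpen_disc.mem_nhds zero_mem_disc] with z hz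
  have h := (ha z hz).tsum_eq
  have h1 : ∑' k : ℕ, a (p + 1 + k) * z ^ (p + 1 + k) = z ^ (p + 1) * g z := by
    rw [hg, ← tsum_mul_left]
    exact tsum_congr fun k => by rw [pow_add]; ring
  rw [h1] at h
  linear_combination -h

/-- Puts both bases in the slit plane near the origin, where the principal powers can be
differentiated. -/
theorem tendsto_bases {p : ℕ} (hp : 1 ≤ p) {f : ℂ → ℂ} (hf : f ∈ ClassA p) :
    Tendsto (fun z => deriv f z / ((p : ℂ) * z ^ (p - 1))) (𝓝[≠] 0) (𝓝 1) ∧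
      Tendsto (fun z => z ^ p / f z) (𝓝[≠] 0) (𝓝 1) := by
  obtain ⟨k, hk, hk0, hfk⟩ := ClassA.exists_factorization hf
  have hp0 : (p : ℂ) ≠ 0 := by exact_mod_cast (by omega : p ≠ 0)
  constructor
  · have hlim : Tendsto (fun z => k z + z * deriv k z / p) (𝓝[≠] 0) (𝓝 1) := by
      have h : ContinuousAt (fun z => k z + z * deriv k z / p) 0 :=
        hk.continuousAt.add ((continuousAt_id.mul hk.deriv.continuousAt).div_const _)
      have h' := h.tendsto
      simp only [hk0, zero_mul, zero_div, add_zero] at h'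
      exact h'.mono_left nhdsWithin_le_nhds
    refine hlim.congr' ?_
    have hev := (hfk.eventuallyEq_nhds.and hk.eventually_analyticAt).filter_mono
      (nhdsWithin_le_nhds (s := {0}ᶜ))
    filter_upwards [hev, self_mem_nhdsWithin] with z ⟨h1, h2⟩ hz
    have hz : z ≠ 0 := hz
    obtain ⟨n, rfl⟩ : ∃ n, p = n + 1 := ⟨p - 1, by omega⟩
    rw [h1.deriv_eq, ((hasDerivAt_pow (n + 1) z).fun_mul h2.differentiableAt.hasDerivAt).deriv]
    simp only [Nat.add_sub_cancel]
    field_simp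
    ring
  · have hlim : Tendsto (fun z => (k z)⁻¹) (𝓝[≠] 0) (𝓝 1) := by
      have h := (hk.continuousAt.inv₀ (by simp [hk0])).tendsto
      simp only [Pi.inv_apply, hk0, inv_one] at h
      exact h.mono_left nhdsWithin_le_nhds
    refine hlim.congr' ?_
    filter_upwards [hfk.filter_mono nhdsWithin_le_nhds, self_mem_nhdsWithin] with z h1 hz
    have hz : z ≠ 0 := hz
    rw [h1, div_mul_eq_div_div, div_self (pow_ne_zero p hz), one_div]

/-- Where the principal powers are differentiable, the product has the expected logarithmic
derivative. -/
theorem mul_deriv_principalProduct {p : ℕ} (hp : 1 ≤ p) {η μ : ℂ} {f : ℂ → ℂ} {z : ℂ}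
    (hz : z ≠ 0) (hf : DifferentiableAt ℂ f z) (hf' : DifferentiableAt ℂ (deriv f) z)
    (h₁ : deriv f z / ((p : ℂ) * z ^ (p - 1)) ∈ Complex.slitPlane)
    (h₂ : z ^ p / f z ∈ Complex.slitPlane) :
    z * deriv (principalProduct p η μ f) z = principalProduct p η μ f z *
      (η * (1 - (p : ℂ) + z * deriv (deriv f) z / deriv f z)
        + μ * ((p : ℂ) - z * deriv f z / f z)) := by
  obtain ⟨n, rfl⟩ : ∃ n, p = n + 1 := ⟨p - 1, by omega⟩
  simp only [Nat.add_sub_cancel] at h₁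
  have hn : ((n + 1 : ℕ) : ℂ) ≠ 0 := by exact_mod_cast Nat.succ_ne_zero n
  have hb₁ := Complex.slitPlane_ne_zero h₁
  have hb₂ := Complex.slitPlane_ne_zero h₂
  have hfz' : deriv f z ≠ 0 := fun h => hb₁ (by simp [h])
  have hfz : f z ≠ 0 := fun h => hb₂ (by simp [h])
  have hden : ((n + 1 : ℕ) : ℂ) * z ^ n ≠ 0 := mul_ne_zero hn (pow_ne_zero n hz)
  have hd₁ := (hf'.hasDerivAt.fun_div ((hasDerivAt_pow n z).const_mul ((n + 1 : ℕ) : ℂ)) hden)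
  have hd₂ := (hasDerivAt_pow (n + 1) z).fun_div hf.hasDerivAt hfz
  have hd := (hd₁.cpow_const (c := η) h₁).fun_mul (hd₂.cpow_const (c := μ) h₂)
  have hpp : principalProduct (n + 1) η μ f = fun z =>
      (deriv f z / (((n + 1 : ℕ) : ℂ) * z ^ n)) ^ η * (z ^ (n + 1) / f z) ^ μ := by
    funext w; simp [principalProduct]
  rw [hpp, hd.deriv, Complex.cpow_sub _ _ hb₁, Complex.cpow_sub _ _ hb₂, Complex.cpow_one,
    Complex.cpow_one]
  beta_reduce
  generalize (deriv f z / (((n + 1 : ℕ) : ℂ) * z ^ n)) ^ η = X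
  generalize (z ^ (n + 1) / f z) ^ μ = Y
  have hzn : z * ((n : ℂ) * z ^ (n - 1)) = n * z ^ n := by
    rcases n with _ | n
    · simp
    · simp [pow_succ]; ring
  have e₁ : z * ((deriv (deriv f) z * (((n + 1 : ℕ) : ℂ) * z ^ n) - deriv f z *
      (((n + 1 : ℕ) : ℂ) * ((n : ℂ) * z ^ (n - 1)))) / (((n + 1 : ℕ) : ℂ) * z ^ n) ^ 2) /
      (deriv f z / (((n + 1 : ℕ) : ℂ) * z ^ n)) = 1 - ((n + 1 : ℕ) : ℂ)
        + z * deriv (deriv f) z / deriv f z := by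
    have : z * (deriv (deriv f) z * (((n + 1 : ℕ) : ℂ) * z ^ n) - deriv f z *
      (((n + 1 : ℕ) : ℂ) * ((n : ℂ) * z ^ (n - 1)))) = ((n + 1 : ℕ) : ℂ) * z ^ n *
        (z * deriv (deriv f) z - n * deriv f z) := by
      linear_combination (-deriv f z * ((n + 1 : ℕ) : ℂ)) * hzn
    rw [← mul_div_assoc, this]
    have hzn0 := pow_ne_zero n hz
    field_simp
    push_cast
    ring
  have e₂ : z * ((((n + 1 : ℕ) : ℂ) * z ^ (n + 1 - 1) * f z - z ^ (n + 1) * deriv f z) / f z ^ 2) /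
      (z ^ (n + 1) / f z) = ((n + 1 : ℕ) : ℂ) - z * deriv f z / f z := by
    simp only [Nat.add_sub_cancel]
    field_simp
    ring
  rw [← e₁, ← e₂]
  ring

theorem operatorF_spec {p : ℕ} {η μ : ℂ} {f : ℂ → ℂ} (hf : f ∈ ClassA0 p η μ) :
    IsOperatorValue p η μ f (operatorF p η μ f) := by
  rw [operatorF, dif_pos hf.2]
  exact hf.2.choose_spec

/-- `Ψ` equals `σ F + γ z F'` on the whole disc, where `F` is the operator value. -/
theorem Psi_eq {p : ℕ} (hp : 1 ≤ p) {η μ : ℂ} (σ γ : ℂ) {f : ℂ → ℂ} (hf : f ∈ ClassA0 p η μ)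
    {z : ℂ} (hz : z ∈ disc) : Psi p η μ σ γ f z =
      σ * operatorF p η μ f z + γ * (z * deriv (operatorF p η μ f) z) := by
  obtain ⟨⟨hF, -⟩, hev⟩ := operatorF_spec hf
  have hfH : Holo f := hf.1.1
  obtain ⟨hb₁, hb₂⟩ := tendsto_bases hp hf.1
  have hs₁ := hb₁.eventually (Complex.isOpen_slitPlane.mem_nhds Complex.one_mem_slitPlane)
  have hs₂ := hb₂.eventually (Complex.isOpen_slitPlane.mem_nhds Complex.one_mem_slitPlane)
  set F := operatorF p η μ f with hFdef
  have hd : ∀ᶠ w in 𝓝[≠] (0 : ℂ), w ∈ disc :=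
    Filter.Eventually.filter_mono nhdsWithin_le_nhds (isOpen_disc.mem_nhds zero_mem_disc)
  have hprod : ∀ᶠ w in 𝓝[≠] (0 : ℂ), f w * deriv f w ≠ 0 := by
    filter_upwards [hs₁, hs₂] with w h₁ h₂ h
    rcases mul_eq_zero.mp h with h | h
    · exact Complex.slitPlane_ne_zero h₂ (by simp [h])
    · exact Complex.slitPlane_ne_zero h₁ (by simp [h])
  -- Cleared of denominators, both sides are holomorphic on the disc, so the identity theorem
  -- spreads the relation from the origin even past zeros of `f` and `f'`.
  have hloc : ∀ᶠ w in 𝓝[≠] (0 : ℂ), w * deriv F w * (f w * deriv f w) =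
      F w * (η * ((1 - (p : ℂ)) * (f w * deriv f w) + w * deriv (deriv f) w * f w)
        + μ * ((p : ℂ) * (f w * deriv f w) - w * (deriv f w * deriv f w))) := by
    filter_upwards [hs₁, hs₂, hd, hprod, eventually_eventually_nhdsWithin.mpr hev,
      self_mem_nhdsWithin, hev] with w h₁ h₂ hwd hw hevw hw0 hFw
    have hw0 : w ≠ 0 := hw0
    rw [isOpen_compl_singleton.nhdsWithin_eq hw0] at hevw
    have hder : deriv F w = deriv (principalProduct p η μ f) w := EventuallyEq.deriv_eq hevw
    rw [hder, mul_deriv_principalProduct hp hw0 (hfH.differentiableAt hwd)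
      (hfH.deriv.differentiableAt hwd) h₁ h₂, hFw]
    have hf0 := left_ne_zero_of_mul hw
    have hf'0 := right_ne_zero_of_mul hw
    field_simp
  have hA : ∀ g : ℂ → ℂ, Holo g → AnalyticOnNhd ℂ g disc := fun g hg w hw => hg.analyticAt hw
  have hid := hA _ differentiableOn_id
  have hglob := AnalyticOnNhd.eqOn_of_preconnected_of_frequently_eq (𝕜 := ℂ) (U := disc)
    (f := fun w => w * deriv F w * (f w * deriv f w))
    (g := fun w => F w * (η * ((1 - (p : ℂ)) * (f w * deriv f w) + w * deriv (deriv f) w * f w)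
        + μ * ((p : ℂ) * (f w * deriv f w) - w * (deriv f w * deriv f w))))
    (by
      have h1 := hA _ hF.deriv
      have h2 := hA _ hfH
      have h3 := hA _ hfH.deriv
      intro w hw
      exact (analyticAt_id.mul (h1 w hw)).mul ((h2 w hw).mul (h3 w hw)))
    (by
      intro w hw
      have h1 := hF.analyticAt hw
      have h2 := hfH.analyticAt hw
      have h3 := hfH.deriv.analyticAt hw
      have h4 := hfH.deriv.deriv.analyticAt hw
      fun_prop)
    isPreconnected_disc zero_mem_disc hloc.frequently
  -- Zeros of `f * f'` are isolated, so the limit defining `Psi` sees only points where the formula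
  -- is genuine.
  have hne : ∀ᶠ w in 𝓝[≠] z, f w * deriv f w ≠ 0 := by
    have hAn : AnalyticOnNhd ℂ (fun w => f w * deriv f w) disc := fun w hw =>
      (hfH.analyticAt hw).mul (hfH.deriv.analyticAt hw)
    rcases (hAn z hz).eventually_eq_zero_or_eventually_ne_zero with h | h
    · exfalso
      have h0 := hAn.eqOn_zero_of_preconnected_of_eventuallyEq_zero isPreconnected_disc hz h
      obtain ⟨w, hw1, hw2⟩ := (hprod.and hd).exists
      exact hw1 (h0 hw2)
    · exact h
  have hdz : ∀ᶠ w in 𝓝[≠] z, w ∈ disc :=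
    Filter.Eventually.filter_mono nhdsWithin_le_nhds (isOpen_disc.mem_nhds hz)
  have hcont : ContinuousAt (fun w => σ * F w + γ * (w * deriv F w)) z :=
    ((hF.differentiableAt hz).continuousAt.const_mul σ).add
      ((continuousAt_id.mul (hF.deriv.differentiableAt hz).continuousAt).const_mul γ)
  refine Tendsto.limUnder_eq ((hcont.tendsto.mono_left nhdsWithin_le_nhds).congr' ?_)
  filter_upwards [hne, hdz] with w hw hwd
  have hf0 := left_ne_zero_of_mul hw
  have hf'0 := right_ne_zero_of_mul hw
  have hg := hglob hwd
  simp only at hg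
  have hzF : w * deriv F w = F w * (η * (1 - (p : ℂ) + w * deriv (deriv f) w / deriv f w)
      + μ * ((p : ℂ) - w * deriv f w / f w)) := by
    refine mul_right_cancel₀ hw (hg.trans ?_)
    field_simp
  rw [psiFormula, ← hFdef, hzF]
  ring

end DiffSub

end

/-! ### Conclusion. -/

theorem mainTheorem2 (p : ℕ) (hp : 1 ≤ p) (η μ σ γ : ℂ) (hημ : (η, μ) ≠ (0, 0)) (hγ : γ ≠ 0)
    (q : ℂ → ℂ) (hq : DiffSub.Univalent q) (hq0 : q 0 = 1)
    (hRe : ∀ z ∈ DiffSub.disc,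
      max 0 (-(σ / γ).re) < (1 + z * deriv (deriv q) z / deriv q z).re)
    (f : ℂ → ℂ) (hf : f ∈ DiffSub.ClassA0 p η μ)
    (hΨ : DiffSub.Subordinate (DiffSub.Psi p η μ σ γ f)
      (fun z => σ * q z + γ * (z * deriv q z))) :
    DiffSub.Subordinate (DiffSub.operatorF p η μ f) q ∧
      DiffSub.IsBestDominant (fun w₁ w₂ _ => σ * w₁ + γ * w₂)
        (fun z => σ * q z + γ * (z * deriv q z)) 1 q := by
  have hdom : ∀ P : ℂ → ℂ, P ∈ DiffSub.HoloClass 1 →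
      DiffSub.Subordinate (fun z => σ * P z + γ * (z * deriv P z))
        (fun z => σ * q z + γ * (z * deriv q z)) → DiffSub.Subordinate P q := by
    rintro P ⟨hP, hP0⟩ ⟨ω, hω, hωm, hω0, hωeq⟩
    refine DiffSub.subordinate_of_linear_subordinate (c := σ / γ) hq
      (fun z hz => (max_lt_iff.mp (hRe z hz)).1) (fun z hz => ?_) hP (hP0.trans hq0.symm)
      ⟨ω, hω, hωm, hω0, fun z hz => ?_⟩
    · have := (max_lt_iff.mp (hRe z hz)).2
      rw [Complex.add_re]
      linarith
    · have h := hωeq z hz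
      field_simp
      linear_combination h
  -- A dominant `r` is tested on the solution `q`, with `ω = id`.
  refine ⟨hdom _ (DiffSub.operatorF_spec hf).1 ?_, hq, ⟨hq.1, fun P hP => hdom P hP.1 hP.2⟩,
    fun r hr => hr.2 q ⟨⟨hq.1, hq0⟩, id, differentiableOn_id, fun z hz => hz, rfl,
      fun z _ => rfl⟩⟩
  obtain ⟨ω, hω, hωm, hω0, hωeq⟩ := hΨ
  exact ⟨ω, hω, hωm, hω0, fun z hz => by rw [← hωeq z hz, DiffSub.Psi_eq hp σ γ hf hz]⟩
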